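/- We use the LOCAL model. The network is a finite simple connected graph with $n$ nodes, and each node $v$ numbers its neighbours by ports $0,\dots,\deg(v)-1$. All nodes run the same algorithm. Initially a node knows only $n$, the maximum degree, its own degree, and its own random number; these numbers are independent and uniform on $[0,1]$. In each synchronous round every node sends a message to each neighbour, receives a message from each neighbour, and updates its state. Messages and local computation are unbounded. A Monte Carlo algorithm with running time $T\colon\mathbb{N}\to\mathbb{N}$ stops after $T(n)$ rounds, when each node announces its own output (a random variable). For every integer $d\ge 2$ there is a constant $\gamma>0$ such that the following holds. For every constant $c>0$ there is no Monte Carlo distributed algorithm with running time $T(n)=o(\log\log n)$ that, for all sufficiently large $n$ and for every $n$-node connected, $d$-regular, bipartite graph of girth at least $\gamma\log n$ with any port numbering, outputs a proper node colouring with $d$ colours with probability at least $1-1/n^{c}$. -/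

import Mathlib

open MeasureTheory Filter Asymptotics

/-- A (randomised) distributed algorithm in the LOCAL model, with outputs in `Out` and no
task-specific input. Every node runs the same algorithm. There is no bound on local computation or
on the size of messages. A node of degree `k` addresses its neighbours through ports `0, …, k-1`. -/
structure LocalAlgorithm (Out : Type) where
  /-- Local states of a node. -/
  State : Type
  /-- Messages. -/
  Msg : Type
  /-- Initial state of a node, computed from the number of nodes `n`, the maximum degree `Δ`,
  its own degree `k`, and its own random number in `[0,1]`. -/
  init : (n Δ k : ℕ) → unitInterval → State
  /-- The message that a node of degree `k` sends through each of its ports. -/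
  send : (k : ℕ) → State → Fin k → Msg
  /-- The new state of a node of degree `k`, given the messages received through its ports. -/
  receive : (k : ℕ) → State → (Fin k → Msg) → State
  /-- The local output announced after the last round. -/
  output : State → Out

/-- A port numbering: each node `v` numbers its neighbours by `0, …, deg v - 1`. -/
def PortNumbering {V : Type} [Fintype V] (G : SimpleGraph V) [DecidableRel G.Adj] : Type :=
  (v : V) → Fin (G.degree v) ≃ G.neighborSet v

namespace LocalAlgorithm

variable {V Out : Type} [Fintype V]

/-- `A.stateAfter G P x t v` is the state of node `v` after `t` synchronous communication rounds
of `A` in the network `G` with ports `P`, where node `w` holds the random number `x w`. -/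
def stateAfter (A : LocalAlgorithm Out) (G : SimpleGraph V) [DecidableRel G.Adj]
    (P : PortNumbering G) (x : V → unitInterval) : ℕ → V → A.State
  | 0, v => A.init (Fintype.card V) G.maxDegree (G.degree v) (x v)
  | t + 1, v =>
      A.receive (G.degree v) (A.stateAfter G P x t v) fun i =>
        A.send (G.degree (P v i : V)) (A.stateAfter G P x t (P v i : V))
          ((P (P v i : V)).symm ⟨v, G.adj_symm (P v i).2⟩)

/-- The output of node `v` when `A` is run for `t` rounds. -/
def run (A : LocalAlgorithm Out) (G : SimpleGraph V) [DecidableRel G.Adj]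
    (P : PortNumbering G) (t : ℕ) (x : V → unitInterval) (v : V) : Out :=
  A.output (A.stateAfter G P x t v)

end LocalAlgorithm

/-- `φ` is a proper node colouring of `G`. -/
def IsProperNodeColouring {V C : Type} (G : SimpleGraph V) (φ : V → C) : Prop :=
  ∀ u v : V, G.Adj u v → φ u ≠ φ v

/-- Running `A` for `t` rounds in `G` with ports `P`, where the nodes hold independent uniform
random numbers from `[0,1]`, gives a proper node `d`-colouring with probability at least `q`.
The outputs are required to be random variables, so that this probability makes sense. -/
def LocalAlgorithm.ColoursWithProbability {V : Type} [Fintype V] {d : ℕ}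
    (A : LocalAlgorithm (Fin d)) (G : SimpleGraph V) [DecidableRel G.Adj]
    (P : PortNumbering G) (t : ℕ) (q : ℝ) : Prop :=
  (∀ v : V, Measurable fun x : V → unitInterval => A.run G P t x v) ∧
    q ≤ (volume : Measure (V → unitInterval)).real
      {x | IsProperNodeColouring G (A.run G P t x)}

/-! Label the edges so that every node has one edge of each label `i : Fin d`. A proper
`d`-colouring never lets both ends of an edge labelled `i` choose colour `i`, and even this weaker
requirement is hard. The argument is round elimination, carried out directly on a finite graph.

Given a colouring rule that sees radius `t + 1`, a node claims its edge `i` if colour `i` has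
conditional probability above a threshold, given what both ends of the edge see. Then a node picks
an `i` whose claim is almost certain given the ball of radius `t`. Large girth makes the views of
two edges at a node overlap only in that ball, so conditional independence bounds the new failure
probability (`exists_orientation_of_colouring`, `exists_colouring_of_orientation`,
`HasLocalColouring.shrink`). Each eliminated round costs a constant root of the failure probability.
At radius 0 the two ends are independent, so failure is at least `1 / d ^ 2`. Hence a `t`-round
algorithm fails with probability above `η ^ ((6 * (d + 1)) ^ t)`, which exceeds `1 / n ^ c`
eventually when `t = o(log log n)`.

The graphs are Cayley graphs of groups generated by `d` involutions. Left translation makes all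
nodes alike, so one function, the output at `1`, describes the algorithm. The involutions are
inversions in disjoint circles, reduced modulo a prime `p`. Ping-pong over the integers and a size
bound exclude reduced relations of length up to order `log p`, while the group has at most `p ^ 4`
elements. Determinant `-1` of the generators gives bipartiteness. -/

section ProductMeasure

/-! ### Conditional expectation and independence on finite product spaces. -/

open scoped ENNReal
open Classical in
theorem measurePreserving_piecewise {ι Ω : Type*} [Fintype ι] [MeasurableSpace Ω] (ν : Measure Ω)
    [IsProbabilityMeasure ν] (S : Set ι) :
    MeasurePreserving (fun z : (ι → Ω) × (ι → Ω) => S.piecewise z.1 z.2)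
      ((Measure.pi fun _ => ν).prod (Measure.pi fun _ => ν)) (Measure.pi fun _ => ν) := by
  have hm : Measurable (fun z : (ι → Ω) × (ι → Ω) => S.piecewise z.1 z.2) := by
    refine measurable_pi_lambda _ fun i => ?_
    by_cases hi : i ∈ S
    · simp only [Set.piecewise, hi, if_true]; exact (measurable_pi_apply i).comp measurable_fst
    · simp only [Set.piecewise, hi, if_false]; exact (measurable_pi_apply i).comp measurable_snd
  refine ⟨hm, (Measure.pi_eq fun s hs => ?_).symm⟩
  rw [Measure.map_apply hm (MeasurableSet.univ_pi hs)]
  have : (fun z : (ι → Ω) × (ι → Ω) => S.piecewise z.1 z.2) ⁻¹' Set.univ.pi s =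
      (Set.univ.pi fun i => if i ∈ S then s i else Set.univ) ×ˢ
        (Set.univ.pi fun i => if i ∈ S then Set.univ else s i) := by
    ext z
    simp only [Set.mem_preimage, Set.mem_univ_pi, Set.mem_prod, ← forall_and]
    refine forall_congr' fun i => ?_
    by_cases hi : i ∈ S <;> simp [Set.piecewise, hi]
  rw [this, Measure.prod_prod, Measure.pi_pi, Measure.pi_pi, ← Finset.prod_mul_distrib]
  refine Finset.prod_congr rfl fun i _ => ?_
  by_cases hi : i ∈ S <;> simp [hi]

theorem measurePreserving_comp_equiv {ι Ω : Type*} [Fintype ι] [MeasurableSpace Ω] (ν : Measure Ω)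
    [IsProbabilityMeasure ν] (e : ι ≃ ι) :
    MeasurePreserving (fun x : ι → Ω => x ∘ e) (Measure.pi fun _ => ν) (Measure.pi fun _ => ν) := by
  have hm : Measurable (fun x : ι → Ω => x ∘ e) :=
    measurable_pi_lambda _ fun i => measurable_pi_apply (e i)
  refine ⟨hm, (Measure.pi_eq fun s hs => ?_).symm⟩
  rw [Measure.map_apply hm (MeasurableSet.univ_pi hs)]
  have : (fun x : ι → Ω => x ∘ e) ⁻¹' Set.univ.pi s = Set.univ.pi fun i => s (e.symm i) := by
    ext x
    simp only [Set.mem_preimage, Set.mem_univ_pi, Function.comp_apply]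
    exact ⟨fun h i => by simpa using h (e.symm i), fun h i => by simpa using h (e i)⟩
  rw [this, Measure.pi_pi]
  exact Fintype.prod_equiv e.symm _ _ fun _ => rfl

open Classical in
theorem piecewise_congr_left {ι Ω : Type*} {S : Set ι} {x x' y : ι → Ω} (h : ∀ i ∈ S, x i = x' i) :
    S.piecewise x y = S.piecewise x' y := by
  ext i
  by_cases hi : i ∈ S <;> simp [hi, h]

variable {ι Ω : Type*} [Fintype ι] [MeasurableSpace Ω]

open Classical in
/-- The conditional expectation of `f` given the coordinates in `S`: all other coordinates are
averaged out. -/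
noncomputable def condAvg (ν : Measure Ω) (S : Set ι) (f : (ι → Ω) → ℝ≥0∞) (x : ι → Ω) : ℝ≥0∞ :=
  ∫⁻ y, f (S.piecewise x y) ∂(Measure.pi fun _ => ν)

theorem dependsOn_condAvg (ν : Measure Ω) (S : Set ι) (f : (ι → Ω) → ℝ≥0∞) : DependsOn (condAvg ν S f) S := by
  intro x x' h
  simp only [condAvg, piecewise_congr_left h]

variable {ν : Measure Ω} [IsProbabilityMeasure ν]

open Classical in
theorem measurable_condAvg {S : Set ι} {f : (ι → Ω) → ℝ≥0∞} (hf : Measurable f) :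
    Measurable (condAvg ν S f) :=
  (hf.comp (measurePreserving_piecewise ν S).measurable).lintegral_prod_right'

-- Resampling the coordinates outside `S` preserves the product measure and does not change `g`, so
-- `g` leaves the inner integral. This is the defining property of conditional expectation.
open Classical in
theorem lintegral_mul_condAvg {S : Set ι} {f g : (ι → Ω) → ℝ≥0∞} (hf : Measurable f)
    (hg : Measurable g) (hgS : DependsOn g S) :
    ∫⁻ x, g x * condAvg ν S f x ∂(Measure.pi fun _ => ν) =
      ∫⁻ x, g x * f x ∂(Measure.pi fun _ => ν) := by
  have hp := measurePreserving_piecewise ν S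
  rw [← hp.lintegral_comp (f := fun x => g x * f x) (hg.mul hf),
    lintegral_prod (fun z : (ι → Ω) × (ι → Ω) =>
      g (S.piecewise z.1 z.2) * f (S.piecewise z.1 z.2)) ((hg.mul hf).comp hp.measurable).aemeasurable]
  refine lintegral_congr fun x => ?_
  rw [condAvg, ← lintegral_const_mul]
  · refine lintegral_congr fun y => ?_
    rw [hgS (x := S.piecewise x y) (y := x)]
    intro i hi
    simp [hi]
  · exact hf.comp (hp.measurable.comp measurable_prodMk_left)

theorem lintegral_condAvg {S : Set ι} {f : (ι → Ω) → ℝ≥0∞} (hf : Measurable f) :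
    ∫⁻ x, condAvg ν S f x ∂(Measure.pi fun _ => ν) = ∫⁻ x, f x ∂(Measure.pi fun _ => ν) := by
  simpa using lintegral_mul_condAvg (ν := ν) (g := fun _ => 1) hf measurable_const
    (S := S) (fun _ _ _ => rfl)

open Classical in
theorem lintegral_mul_of_disjoint {A B : Set ι} (hAB : Disjoint A B) {f g : (ι → Ω) → ℝ≥0∞}
    (hf : Measurable f) (hg : Measurable g) (hfA : DependsOn f A) (hgB : DependsOn g B) :
    ∫⁻ x, f x * g x ∂(Measure.pi fun _ => ν) =
      (∫⁻ x, f x ∂(Measure.pi fun _ => ν)) * ∫⁻ x, g x ∂(Measure.pi fun _ => ν) := by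
  rw [← lintegral_mul_condAvg hg hf hfA, ← lintegral_mul_const _ hf]
  refine lintegral_congr fun x => congrArg (f x * ·) (lintegral_congr fun y => hgB fun i hi => ?_)
  simp [hAB.notMem_of_mem_right hi]

theorem lintegral_prod_of_pairwise_disjoint {κ : Type*} (s : Finset κ) {A : κ → Set ι}
    (hA : (s : Set κ).PairwiseDisjoint A) {f : κ → (ι → Ω) → ℝ≥0∞}
    (hf : ∀ k ∈ s, Measurable (f k)) (hfA : ∀ k ∈ s, DependsOn (f k) (A k)) :
    ∫⁻ x, ∏ k ∈ s, f k x ∂(Measure.pi fun _ => ν) =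
      ∏ k ∈ s, ∫⁻ x, f k x ∂(Measure.pi fun _ => ν) := by
  classical
  induction s using Finset.induction_on with
  | empty => simp
  | insert k s hk ih =>
    simp only [Finset.prod_insert hk]
    rw [lintegral_mul_of_disjoint (A := A k) (B := ⋃ j ∈ s, A j), ih]
    · exact hA.subset (by simp)
    · exact fun j hj => hf j (by simp [hj])
    · exact fun j hj => hfA j (by simp [hj])
    · simp only [Set.disjoint_iUnion_right]
      intro j hj
      exact hA (by simp) (by simp [hj]) (by rintro rfl; exact hk hj)
    · exact hf k (by simp)
    · exact Finset.measurable_prod _ fun j hj => hf j (by simp [hj])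
    · exact hfA k (by simp)
    · intro x y hxy
      refine Finset.prod_congr rfl fun j hj => hfA j (by simp [hj]) fun i hi => hxy i ?_
      simp only [Set.mem_iUnion]
      exact ⟨j, hj, hi⟩

-- Once the coordinates in `S` are fixed, the factors depend on the disjoint sets `A k \ S`, hence
-- are independent.
open Classical in
theorem condAvg_prod {κ : Type*} (s : Finset κ) {S : Set ι} {A : κ → Set ι}
    (hA : ∀ k ∈ s, ∀ j ∈ s, k ≠ j → A k ∩ A j ⊆ S) {f : κ → (ι → Ω) → ℝ≥0∞}
    (hf : ∀ k ∈ s, Measurable (f k)) (hfA : ∀ k ∈ s, DependsOn (f k) (A k)) (x : ι → Ω) :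
    condAvg ν S (fun x => ∏ k ∈ s, f k x) x = ∏ k ∈ s, condAvg ν S (f k) x := by
  refine lintegral_prod_of_pairwise_disjoint s (A := fun k => A k \ S)
    (f := fun k y => f k (S.piecewise x y)) ?_ ?_ ?_
  · intro k hk j hj hkj
    refine Set.disjoint_left.2 fun i hi hi' => hi.2 (hA k hk j hj hkj ⟨hi.1, hi'.1⟩)
  · exact fun k hk => (hf k hk).comp
      ((measurePreserving_piecewise ν S).measurable.comp measurable_prodMk_left)
  · intro k hk y z hyz
    refine hfA k hk fun i hi => ?_
    by_cases hiS : i ∈ S <;> simp [hiS]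
    exact hyz i ⟨hi, hiS⟩

theorem condAvg_mul {S A B : Set ι} (hAB : A ∩ B ⊆ S) {f g : (ι → Ω) → ℝ≥0∞}
    (hf : Measurable f) (hg : Measurable g) (hfA : DependsOn f A) (hgB : DependsOn g B)
    (x : ι → Ω) :
    condAvg ν S (fun x => f x * g x) x = condAvg ν S f x * condAvg ν S g x := by
  have := condAvg_prod (ν := ν) (Finset.univ : Finset Bool) (S := S)
    (A := fun b => if b then A else B) (f := fun b => if b then f else g) (by
      rintro (_ | _) - (_ | _) - h <;> simp at h ⊢
      · rwa [Set.inter_comm]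
      · exact hAB)
    (by rintro (_ | _) - <;> simpa) (by rintro (_ | _) - <;> simpa) x
  simpa using this

open Classical in
theorem condAvg_comp_equiv {S : Set ι} (e : ι ≃ ι) (he : ∀ i, e i ∈ S ↔ i ∈ S)
    {f : (ι → Ω) → ℝ≥0∞} (hf : Measurable f) (x : ι → Ω) :
    condAvg ν S (fun x => f (x ∘ e)) x = condAvg ν S f (x ∘ e) := by
  have hp := (measurePreserving_piecewise ν S).measurable
  rw [condAvg, condAvg, ← (measurePreserving_comp_equiv ν e).lintegral_comp
    (f := fun y => f (S.piecewise (x ∘ e) y)) (hf.comp (hp.comp measurable_prodMk_left))]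
  refine lintegral_congr fun y => congrArg f (funext fun i => ?_)
  by_cases hi : i ∈ S <;> simp [Set.piecewise, hi, he]

end ProductMeasure

/-! ### One step of round elimination, and the case of zero rounds. -/

section RoundElimination

open scoped ENNReal

theorem dependsOn_indicator_one {ι Ω : Type*} {S : Set ι} {E : Set (ι → Ω)} (h : DependsOn (· ∈ E) S) :
    DependsOn (E.indicator (1 : (ι → Ω) → ℝ≥0∞)) S := by
  intro x y hxy
  have : (x ∈ E) = (y ∈ E) := h hxy
  by_cases hx : x ∈ E
  · simp [hx, this ▸ hx]
  · simp [hx, this ▸ hx]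

variable {ι Ω : Type*} [Fintype ι] [MeasurableSpace Ω] {ν : Measure Ω} [IsProbabilityMeasure ν]

/-- The set where the conditional probability of `E` is small depends only on `S`, so on it `E` may
be replaced by that conditional probability under the integral. -/
theorem measure_setOf_condAvg_le_inter_le {S : Set ι} {E : Set (ι → Ω)} (hE : MeasurableSet E)
    (θ : ℝ≥0∞) :
    (Measure.pi fun _ => ν) ({x | condAvg ν S (E.indicator 1) x ≤ θ} ∩ E) ≤ θ := by
  have hm : Measurable (E.indicator (1 : (ι → Ω) → ℝ≥0∞)) := measurable_one.indicator hE
  set G := {x | condAvg ν S (E.indicator 1) x ≤ θ} with hGdef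
  have hG : MeasurableSet G := measurableSet_le (measurable_condAvg hm) measurable_const
  have hGS : DependsOn (G.indicator (1 : (ι → Ω) → ℝ≥0∞)) S := by
    intro x y hxy
    have : x ∈ G ↔ y ∈ G := by simp only [hGdef, Set.mem_ofPred_eq, dependsOn_condAvg ν S _ hxy]
    by_cases hx : x ∈ G
    · simp [hx, this.1 hx]
    · simp [hx, mt this.2 hx]
  have h := lintegral_mul_condAvg (ν := ν) hm (measurable_one.indicator hG) hGS
  calc (Measure.pi fun _ => ν) (G ∩ E)
      = ∫⁻ x, G.indicator 1 x * E.indicator 1 x ∂(Measure.pi fun _ => ν) := by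
        rw [← lintegral_indicator_one (hG.inter hE)]
        exact lintegral_congr fun x => by rw [Set.inter_indicator_one]; rfl
    _ = ∫⁻ x, G.indicator 1 x * condAvg ν S (E.indicator 1) x ∂(Measure.pi fun _ => ν) := h.symm
    _ ≤ ∫⁻ _, θ ∂(Measure.pi fun _ : ι => ν) := by
        refine lintegral_mono fun x => ?_
        by_cases hx : x ∈ G
        · rw [Set.indicator_of_mem hx, Pi.one_apply, one_mul]
          exact hx
        · simp [hx]
    _ = θ := by simp

variable {d : ℕ}

/-- From a local colouring `F` for which the events "both ends of edge `i` choose `i`" are unlikely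
to a local orientation `O` for which "both ends of edge `i` claim it" and "no edge is claimed" are
unlikely. -/
theorem exists_orientation_of_colouring (e : Fin d → ι ≃ ι) (he : ∀ i j, e i (e i j) = j)
    {B : Set ι} {F : (ι → Ω) → Fin d} (hF : Measurable F) (hFB : DependsOn F B) {p : ℝ≥0∞}
    (hp : ∀ i, (Measure.pi fun _ => ν) {x | F x = i ∧ F (x ∘ e i) = i} ≤ p) (θ : ℝ≥0∞) :
    ∃ O : Fin d → Set (ι → Ω), (∀ i, MeasurableSet (O i)) ∧
      (∀ i, DependsOn (· ∈ O i) (B ∩ e i ⁻¹' B)) ∧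
      (∀ i, θ ^ 2 * (Measure.pi fun _ => ν) {x | x ∈ O i ∧ x ∘ e i ∈ O i} ≤ p) ∧
      (Measure.pi fun _ => ν) (⋂ i, (O i)ᶜ) ≤ d * θ := by
  have hE : ∀ i, MeasurableSet (F ⁻¹' {i}) := fun i => hF (measurableSet_singleton i)
  have hm : ∀ i, Measurable ((F ⁻¹' {i}).indicator (1 : (ι → Ω) → ℝ≥0∞)) :=
    fun i => measurable_one.indicator (hE i)
  have hσ := fun i => measurePreserving_comp_equiv ν (e i)
  -- `B ∩ e i ⁻¹' B` holds the coordinates seen by both ends of edge `i`. The edge is claimed where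
  -- `u i` exceeds `θ`.
  set u : Fin d → (ι → Ω) → ℝ≥0∞ :=
    fun i => condAvg ν (B ∩ e i ⁻¹' B) ((F ⁻¹' {i}).indicator 1) with hu
  have hO : ∀ i, MeasurableSet {x | θ < u i x} :=
    fun i => measurableSet_lt measurable_const (measurable_condAvg (hm i))
  refine ⟨fun i => {x | θ < u i x}, hO, fun i x y hxy => ?_, fun i => ?_, ?_⟩
  · simp only [Set.mem_ofPred_eq, hu, dependsOn_condAvg ν _ _ hxy]
  · have hdep : DependsOn ((F ⁻¹' {i}).indicator (1 : (ι → Ω) → ℝ≥0∞)) B :=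
      dependsOn_indicator_one fun x y hxy => by simp [hFB hxy]
    have hinv : ∀ x, u i (x ∘ e i) = condAvg ν (B ∩ e i ⁻¹' B)
        (fun x => (F ⁻¹' {i}).indicator 1 (x ∘ e i)) x := fun x =>
      (condAvg_comp_equiv (e i) (fun j => by simp [he, and_comm]) (hm i) x).symm
    -- Given the shared coordinates the two ends choose independently, so where both claim, both
    -- choose `i` with conditional probability at least `θ ^ 2`.
    have hmul := condAvg_mul (ν := ν) (A := B) (B := e i ⁻¹' B) subset_rfl (hm i)
      ((hm i).comp (hσ i).measurable) hdep
      (fun x y hxy => hdep fun j hj => hxy (e i j) (by simpa [he] using hj))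
    calc θ ^ 2 * (Measure.pi fun _ => ν) {x | θ < u i x ∧ θ < u i (x ∘ e i)}
        = ∫⁻ x, {x | θ < u i x ∧ θ < u i (x ∘ e i)}.indicator (fun _ => θ ^ 2) x
            ∂(Measure.pi fun _ => ν) :=
          (lintegral_indicator_const ((hO i).inter ((hσ i).measurable (hO i))) _).symm
      _ ≤ ∫⁻ x, condAvg ν (B ∩ e i ⁻¹' B) (fun x => (F ⁻¹' {i}).indicator 1 x *
            (F ⁻¹' {i}).indicator 1 (x ∘ e i)) x ∂(Measure.pi fun _ => ν) := by
          refine lintegral_mono fun x => Set.indicator_le (fun x hx => ?_) x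
          refine le_trans ?_ (hmul x).ge
          rw [sq]
          refine mul_le_mul' hx.1.le (hx.2.le.trans ?_)
          rw [hinv]
          rfl
      _ = ∫⁻ x, (F ⁻¹' {i}).indicator 1 x * (F ⁻¹' {i}).indicator 1 (x ∘ e i)
            ∂(Measure.pi fun _ => ν) :=
          lintegral_condAvg ((hm i).mul ((hm i).comp (hσ i).measurable))
      _ = (Measure.pi fun _ => ν) {x | F x = i ∧ F (x ∘ e i) = i} := by
          have h2 : MeasurableSet {x | F x = i ∧ F (x ∘ e i) = i} :=
            (hE i).inter ((hσ i).measurable (hE i))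
          rw [← lintegral_indicator_one h2]
          refine lintegral_congr fun x => ?_
          by_cases h : F x = i <;> by_cases h' : F (x ∘ e i) = i <;>
            simp [Set.indicator, h, h']
      _ ≤ p := hp i
  · calc (Measure.pi fun _ => ν) (⋂ i, {x | θ < u i x}ᶜ)
        ≤ (Measure.pi fun _ => ν) (⋃ i, {x | u i x ≤ θ} ∩ F ⁻¹' {i}) := by
          -- If nothing is claimed, the colour `F x` was chosen although its conditional probability
          -- was at most `θ`.
          refine measure_mono fun x hx => Set.mem_iUnion.2 ⟨F x, ?_, rfl⟩
          simpa using Set.mem_iInter.1 hx (F x)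
      _ ≤ ∑ i, (Measure.pi fun _ => ν) ({x | u i x ≤ θ} ∩ F ⁻¹' {i}) :=
          measure_iUnion_fintype_le _ _
      _ ≤ ∑ _i : Fin d, θ :=
          Finset.sum_le_sum fun i _ => measure_setOf_condAvg_le_inter_le (hE i) θ
      _ = d * θ := by simp

open Classical in
/-- From a local orientation `O` to a local colouring that looks at fewer coordinates. -/
theorem exists_colouring_of_orientation (hd : 0 < d) (e : Fin d → ι ≃ ι)
    {D : Fin d → Set ι} {S : Set ι} (hDS : ∀ i j, i ≠ j → D i ∩ D j ⊆ S)
    {O : Fin d → Set (ι → Ω)} (hO : ∀ i, MeasurableSet (O i))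
    (hOD : ∀ i, DependsOn (· ∈ O i) (D i)) (ε : ℝ≥0∞) :
    ∃ (F : (ι → Ω) → Fin d) (r : ℝ≥0∞), Measurable F ∧ DependsOn F S ∧
      ε ^ d * r ≤ (Measure.pi fun _ => ν) (⋂ i, (O i)ᶜ) ∧
      ∀ i, (Measure.pi fun _ => ν) {x | F x = i ∧ F (x ∘ e i) = i} ≤
        (Measure.pi fun _ => ν) {x | x ∈ O i ∧ x ∘ e i ∈ O i} + 2 * ε + 2 * r := by
  have hσ := fun i => measurePreserving_comp_equiv ν (e i)
  have hm : ∀ i, Measurable ((O i)ᶜ.indicator (1 : (ι → Ω) → ℝ≥0∞)) :=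
    fun i => measurable_one.indicator (hO i).compl
  set v : Fin d → (ι → Ω) → ℝ≥0∞ := fun i => condAvg ν S ((O i)ᶜ.indicator 1) with hv
  have hG : ∀ i, MeasurableSet {x | v i x ≤ ε} :=
    fun i => measurableSet_le (measurable_condAvg (hm i)) measurable_const
  -- Choose some `i` that is unclaimed with conditional probability at most `ε`; colour `0` is the
  -- fallback, used with probability `r`.
  let φ : (Fin d → Prop) → Fin d := fun b => if h : ∃ i, b i then h.choose else ⟨0, hd⟩
  have hφ : ∀ b : Fin d → Prop, (∃ i, b i) → b (φ b) := fun b hb => by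
    simp only [φ, dif_pos hb]
    exact hb.choose_spec
  have hN : MeasurableSet (⋂ i, {x | v i x ≤ ε}ᶜ) := MeasurableSet.iInter fun i => (hG i).compl
  refine ⟨fun x => φ fun i => v i x ≤ ε, (Measure.pi fun _ => ν) (⋂ i, {x | v i x ≤ ε}ᶜ),
    ?_, ?_, ?_, fun i => ?_⟩
  · exact (Measurable.of_discrete (f := φ)).comp
      (measurable_pi_lambda _ fun i => measurableSet_setOfPred.1 (hG i))
  · intro x y hxy
    simp only [hv, dependsOn_condAvg ν S _ hxy]
  · have hprod := condAvg_prod (ν := ν) Finset.univ (S := S) (A := D)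
      (fun i _ j _ hij => hDS i j hij) (f := fun i => (O i)ᶜ.indicator (1 : (ι → Ω) → ℝ≥0∞))
      (fun i _ => hm i) (fun i _ => dependsOn_indicator_one fun x y hxy => by
        simpa using not_congr (iff_of_eq (hOD i hxy)))
    calc ε ^ d * (Measure.pi fun _ => ν) (⋂ i, {x | v i x ≤ ε}ᶜ)
        = ∫⁻ x, (⋂ i, {x | v i x ≤ ε}ᶜ).indicator (fun _ => ε ^ d) x
            ∂(Measure.pi fun _ => ν) := (lintegral_indicator_const hN _).symm
      _ ≤ ∫⁻ x, condAvg ν S (fun x => ∏ i, (O i)ᶜ.indicator 1 x) x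
            ∂(Measure.pi fun _ => ν) := by
          refine lintegral_mono fun x => Set.indicator_le (fun x hx => ?_) x
          refine le_trans ?_ (hprod x).ge
          calc ε ^ d = ∏ _i : Fin d, ε := by simp
            _ ≤ _ := Finset.prod_le_prod' fun i _ => by
                have := Set.mem_iInter.1 hx i
                simp only [Set.mem_compl_iff, Set.mem_ofPred_eq, not_le] at this
                exact this.le
      _ = ∫⁻ x, ∏ i, (O i)ᶜ.indicator 1 x ∂(Measure.pi fun _ => ν) :=
          lintegral_condAvg (Finset.measurable_prod _ fun i _ => hm i)
      _ = (Measure.pi fun _ => ν) (⋂ i, (O i)ᶜ) := by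
          rw [← lintegral_indicator_one (MeasurableSet.iInter fun i => (hO i).compl)]
          refine lintegral_congr fun x => ?_
          by_cases h : x ∈ ⋂ i, (O i)ᶜ
          · rw [Set.indicator_of_mem h]
            exact Finset.prod_eq_one fun i _ => by
              rw [Set.indicator_of_mem (Set.mem_iInter.1 h i)]; rfl
          · rw [Set.indicator_of_notMem h]
            obtain ⟨i, hi⟩ := not_forall.1 (mt Set.mem_iInter.2 h)
            exact Finset.prod_eq_zero (Finset.mem_univ i) (Set.indicator_of_notMem hi _)
  · set N := ⋂ i, {x | v i x ≤ ε}ᶜ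
    set W := {x | v i x ≤ ε} ∩ (O i)ᶜ
    have hWle : (Measure.pi fun _ => ν) W ≤ ε :=
      measure_setOf_condAvg_le_inter_le (hO i).compl ε
    have hWm : MeasurableSet W := (hG i).inter (hO i).compl
    have key : ∀ x, (φ fun i => v i x ≤ ε) = i → x ∈ N ∨ v i x ≤ ε := by
      intro x hx
      by_cases h : ∃ j, v j x ≤ ε
      · have := hφ (fun i => v i x ≤ ε) h
        rw [hx] at this
        exact Or.inr this
      · refine Or.inl (Set.mem_iInter.2 fun j => ?_)
        exact fun hj => h ⟨j, hj⟩
    -- If both ends choose `i`, then both claim the edge, or one end trusted a claim that was not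
    -- made (`W`), or one end used the fallback (`N`).
    have hsub : {x | (φ fun j => v j x ≤ ε) = i ∧ (φ fun j => v j (x ∘ e i) ≤ ε) = i} ⊆
        {x | x ∈ O i ∧ x ∘ e i ∈ O i} ∪ (W ∪ (fun x => x ∘ e i) ⁻¹' W) ∪
          (N ∪ (fun x => x ∘ e i) ⁻¹' N) := by
      rintro x ⟨h1, h2⟩
      rcases key x h1 with h1 | h1
      · exact Or.inr (Or.inl h1)
      rcases key _ h2 with h2 | h2
      · exact Or.inr (Or.inr h2)
      refine Or.inl ?_
      by_cases h3 : x ∈ O i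
      · by_cases h4 : x ∘ e i ∈ O i
        · exact Or.inl ⟨h3, h4⟩
        · exact Or.inr (Or.inr ⟨h2, h4⟩)
      · exact Or.inr (Or.inl ⟨h1, h3⟩)
    refine (measure_mono hsub).trans ((measure_union_le _ _).trans ?_)
    refine add_le_add ((measure_union_le _ _).trans (add_le_add le_rfl ?_)) ?_
    · refine (measure_union_le _ _).trans ?_
      rw [(hσ i).measure_preimage hWm.nullMeasurableSet, ← two_mul]
      gcongr
    · refine (measure_union_le _ _).trans ?_
      rw [(hσ i).measure_preimage hN.nullMeasurableSet, ← two_mul]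

/-- `B` is a set of coordinates that suffices for a colouring by which the two ends of an edge `i`
both choose `i` with probability at most `p`. -/
def HasLocalColouring (ν : Measure Ω) (e : Fin d → ι ≃ ι) (B : Set ι) (p : ℝ≥0∞) : Prop :=
  ∃ F : (ι → Ω) → Fin d, Measurable F ∧ DependsOn F B ∧
    ∀ i, (Measure.pi fun _ => ν) {x | F x = i ∧ F (x ∘ e i) = i} ≤ p

theorem HasLocalColouring.shrink (hd : 0 < d) {e : Fin d → ι ≃ ι}
    (he : ∀ i j, e i (e i j) = j) {B S : Set ι}
    (hBS : ∀ i j, i ≠ j → (B ∩ e i ⁻¹' B) ∩ (B ∩ e j ⁻¹' B) ⊆ S) {ε : ℝ≥0∞} (hε0 : ε ≠ 0)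
    (hε1 : ε ≤ 1) (h : HasLocalColouring ν e B (ε ^ (3 * (d + 1)))) :
    HasLocalColouring ν e S ((2 * d + 3) * ε) := by
  obtain ⟨F, hF, hFB, hp⟩ := h
  -- With `θ = ε ^ (d + 1)`, double claims have probability at most `ε ^ (3 * (d + 1)) / θ ^ 2 ≤ ε`,
  -- and the fallback at most `d * θ / ε ^ d = d * ε`.
  obtain ⟨O, hO, hOD, hO2, hO0⟩ := exists_orientation_of_colouring e he hF hFB hp (ε ^ (d + 1))
  obtain ⟨F', r, hF', hFS, hr, hfail⟩ := exists_colouring_of_orientation (ν := ν) hd e hBS hO hOD ε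
  have hεtop : ε ≠ ⊤ := (hε1.trans_lt ENNReal.one_lt_top).ne
  refine ⟨F', hF', hFS, fun i => (hfail i).trans ?_⟩
  have h1 : (Measure.pi fun _ => ν) {x | x ∈ O i ∧ x ∘ e i ∈ O i} ≤ ε := by
    have h2 : (ε ^ (d + 1)) ^ 2 * (Measure.pi fun _ => ν) {x | x ∈ O i ∧ x ∘ e i ∈ O i} ≤
        (ε ^ (d + 1)) ^ 2 * ε ^ (d + 1) := (hO2 i).trans_eq (by ring)
    rw [ENNReal.mul_le_mul_iff_right (by simp [hε0]) (by simp [hεtop])] at h2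
    refine h2.trans ?_
    rw [pow_succ]
    exact mul_le_of_le_one_left' (pow_le_one₀ zero_le hε1)
  have h3 : r ≤ d * ε := by
    have h4 : ε ^ d * r ≤ ε ^ d * (d * ε) := (hr.trans hO0).trans_eq (by ring)
    rwa [ENNReal.mul_le_mul_iff_right (by simp [hε0]) (by simp [hεtop])] at h4
  calc _ ≤ ε + 2 * ε + 2 * (d * ε) := by gcongr
    _ = (2 * d + 3) * ε := by ring

/-- The two ends choose independently with the same law, so each colour has probability at most
`√p`; but some colour has probability at least `1 / d`. -/
theorem not_hasLocalColouring_of_disjoint (hd : 0 < d) {e : Fin d → ι ≃ ι}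
    (he : ∀ i j, e i (e i j) = j) {B : Set ι} (hB : ∀ i, Disjoint B (e i ⁻¹' B)) {p : ℝ≥0∞}
    (hp : p * d ^ 2 < 1) : ¬ HasLocalColouring ν e B p := by
  rintro ⟨F, hF, hFB, hFp⟩
  have hE : ∀ i, MeasurableSet (F ⁻¹' {i}) := fun i => hF (measurableSet_singleton i)
  have hσ := fun i => measurePreserving_comp_equiv ν (e i)
  have hm : ∀ i, Measurable ((F ⁻¹' {i}).indicator (1 : (ι → Ω) → ℝ≥0∞)) :=
    fun i => measurable_one.indicator (hE i)
  have hsq : ∀ i, ((Measure.pi fun _ => ν) (F ⁻¹' {i})) ^ 2 ≤ p := by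
    intro i
    have hdep : DependsOn ((F ⁻¹' {i}).indicator (1 : (ι → Ω) → ℝ≥0∞)) B :=
      dependsOn_indicator_one fun x y hxy => by simp [hFB hxy]
    have hmul := lintegral_mul_of_disjoint (ν := ν) (hB i) (hm i)
      ((hm i).comp (hσ i).measurable) hdep
      (fun x y hxy => hdep fun j hj => hxy (e i j) (by simpa [he] using hj))
    have h2 : ∫⁻ x, ((F ⁻¹' {i}).indicator 1 ∘ fun x => x ∘ e i) x ∂(Measure.pi fun _ => ν) =
        (Measure.pi fun _ => ν) (F ⁻¹' {i}) := by
      rw [← lintegral_indicator_one (hE i)]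
      exact (hσ i).lintegral_comp (hm i)
    rw [h2, lintegral_indicator_one (hE i), ← sq] at hmul
    rw [← hmul]
    refine le_trans (le_of_eq ?_) (hFp i)
    have h2 : MeasurableSet {x | F x = i ∧ F (x ∘ e i) = i} :=
      (hE i).inter ((hσ i).measurable (hE i))
    rw [← lintegral_indicator_one h2]
    refine lintegral_congr fun x => ?_
    by_cases h : F x = i <;> by_cases h' : F (x ∘ e i) = i <;> simp [Set.indicator, h, h']
  have htot : (1 : ℝ≥0∞) ≤ ∑ i, (Measure.pi fun _ => ν) (F ⁻¹' {i}) := by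
    have : (⋃ i, F ⁻¹' {i}) = Set.univ := by ext; simp
    rw [← measure_univ (μ := Measure.pi fun _ : ι => ν), ← this]
    exact measure_iUnion_fintype_le _ _
  have : Nonempty (Fin d) := ⟨⟨0, hd⟩⟩
  obtain ⟨i, -, hi⟩ := Finset.exists_max_image Finset.univ
    (fun i => (Measure.pi fun _ => ν) (F ⁻¹' {i})) Finset.univ_nonempty
  have h1 : (1 : ℝ≥0∞) ≤ d * (Measure.pi fun _ => ν) (F ⁻¹' {i}) := by
    refine htot.trans ((Finset.sum_le_sum hi).trans_eq (by simp))
  have h2 : (1 : ℝ≥0∞) ≤ p * d ^ 2 :=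
    calc (1 : ℝ≥0∞) ≤ (d * (Measure.pi fun _ => ν) (F ⁻¹' {i})) ^ 2 := one_le_pow₀ h1
      _ = ((Measure.pi fun _ => ν) (F ⁻¹' {i})) ^ 2 * d ^ 2 := by ring
      _ ≤ p * d ^ 2 := by gcongr; exact hsq i
  exact absurd hp h2.not_gt

end RoundElimination

/-! ### Cayley graphs of involutions without short relations. -/

section CayleyGraph

/-- Involutions `a i` that generate the group `V`, are odd for some 2-colouring of `V`, and have no
nontrivial reduced relation of length less than `L`. -/
structure IsReflectionSystem {V κ : Type*} [Group V] (a : κ → V) (L : ℕ) : Prop where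
  mul_self : ∀ i, a i * a i = 1
  closure_range : Subgroup.closure (Set.range a) = ⊤
  exists_sign : ∃ χ : V → Bool, ∀ g i, χ (g * a i) = !χ g
  prod_ne_one : ∀ l : List κ, l ≠ [] → l.IsChain (· ≠ ·) → l.length < L → (l.map a).prod ≠ 1

/-- The products of at most `t` generators. -/
def wordBall {V κ : Type*} [Group V] (a : κ → V) (t : ℕ) : Set V :=
  {g | ∃ l : List κ, l.length ≤ t ∧ (l.map a).prod = g}

namespace IsReflectionSystem

variable {V κ : Type*} [Group V] {a : κ → V} {L : ℕ}

theorem prod_reverse (h : IsReflectionSystem a L) (l : List κ) :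
    (l.reverse.map a).prod = ((l.map a).prod)⁻¹ := by
  induction l with
  | nil => simp
  | cons i l ih =>
    rw [List.reverse_cons, List.map_append, List.prod_append, ih, List.map_singleton,
      List.prod_singleton, List.map_cons, List.prod_cons, mul_inv_rev,
      ← eq_inv_of_mul_eq_one_left (h.mul_self i)]

theorem exists_reduced (h : IsReflectionSystem a L) (l : List κ) :
    ∃ l' : List κ, l'.IsChain (· ≠ ·) ∧ l'.length ≤ l.length ∧
      (l'.map a).prod = (l.map a).prod := by
  induction l with
  | nil => exact ⟨[], by simp, by simp, rfl⟩
  | cons i l ih =>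
    obtain ⟨l', hc, hl, hp⟩ := ih
    match l', hc, hl, hp with
    | [], _, _, hp => exact ⟨[i], by simp, by simp, by simpa using hp.symm⟩
    | j :: m, hc, hl, hp =>
      by_cases hij : i = j
      · subst hij
        refine ⟨m, hc.tail, by simp at hl ⊢; omega, ?_⟩
        rw [List.map_cons, List.prod_cons, ← hp, List.map_cons, List.prod_cons, ← mul_assoc,
          h.mul_self, one_mul]
      · refine ⟨i :: j :: m, List.isChain_cons_cons.2 ⟨hij, hc⟩, by simpa using hl, ?_⟩
        rw [List.map_cons, List.prod_cons, hp, List.map_cons, List.prod_cons]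

/-- Common first letters cancel. At the first difference, the reverse of one word followed by the
other would be a short reduced relation. -/
theorem eq_of_prod_eq (h : IsReflectionSystem a L) :
    ∀ l l' : List κ, l.IsChain (· ≠ ·) → l'.IsChain (· ≠ ·) → l.length + l'.length < L →
      (l.map a).prod = (l'.map a).prod → l = l'
  | [], [], _, _, _, _ => rfl
  | [], j :: m, _, hc, hL, hp =>
    absurd hp.symm (h.prod_ne_one _ (by simp) hc (by simpa using hL))
  | i :: l, [], hc, _, hL, hp =>
    absurd hp (h.prod_ne_one _ (by simp) hc (by simpa using hL))
  | i :: l, j :: m, hc, hc', hL, hp => by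
    simp only [List.length_cons] at hL
    by_cases hij : i = j
    · subst hij
      rw [h.eq_of_prod_eq l m hc.tail hc'.tail (by omega) (by simpa using hp)]
    · refine absurd ?_ (h.prod_ne_one ((i :: l).reverse ++ j :: m) (by simp) ?_ ?_)
      · rw [List.map_append, List.prod_append, h.prod_reverse, hp, inv_mul_cancel]
      · refine List.IsChain.append ?_ hc' ?_
        · rw [List.isChain_reverse]
          exact hc.imp fun _ _ => Ne.symm
        · intro x hx y hy
          simp at hx hy
          rwa [← hx, ← hy]
      · simp only [List.length_append, List.length_reverse, List.length_cons]
        omega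

/-- This is where girth enters round elimination. If the reduced word of `g` has length `s + 1` and
starts with `k`, multiplying by any `a i` with `i ≠ k` leaves the ball; one of `i`, `j` differs from
`k`. Uniqueness is applied to words of lengths at most `s + 2` and `s + 1`, hence the bound on `L`.
-/
theorem wordBall_inter_subset (h : IsReflectionSystem a L) {s : ℕ} (hs : 2 * s + 3 < L) {i j : κ}
    (hij : i ≠ j) :
    {g | a i * g ∈ wordBall a (s + 1)} ∩ {g | a j * g ∈ wordBall a (s + 1)} ∩ wordBall a (s + 1) ⊆
      wordBall a s := by
  rintro g ⟨⟨hi, hj⟩, l, hl, rfl⟩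
  obtain ⟨w, hw, hwl, hwp⟩ := h.exists_reduced l
  match w, hw, hwl, hwp with
  | [], _, _, hwp => exact ⟨[], by simp, hwp⟩
  | k :: w, hw, hwl, hwp =>
    have key : ∀ i, i ≠ k → a i * (l.map a).prod ∈ wordBall a (s + 1) →
        (l.map a).prod ∈ wordBall a s := by
      rintro i hik ⟨m, hm, hmp⟩
      obtain ⟨u, hu, hul, hup⟩ := h.exists_reduced m
      have := h.eq_of_prod_eq (i :: k :: w) u (List.isChain_cons_cons.2 ⟨hik, hw⟩) hu
        (by simp only [List.length_cons] at hwl ⊢; omega)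
        (by rw [hup, hmp, ← hwp, List.map_cons, List.prod_cons])
      refine ⟨k :: w, ?_, hwp⟩
      rw [← this] at hul
      simp only [List.length_cons] at hul ⊢
      omega
    by_cases hik : i = k
    · exact key j (fun hjk => hij (hik.trans hjk.symm)) hj
    · exact key i hik hi

theorem ne_one (h : IsReflectionSystem a L) (i : κ) : a i ≠ 1 := by
  obtain ⟨χ, hχ⟩ := h.exists_sign
  intro hi
  have := hχ 1 i
  rw [hi, mul_one] at this
  simp at this

theorem injective (h : IsReflectionSystem a L) (hL : 3 ≤ L) : Function.Injective a := by
  intro i j hij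
  have := h.eq_of_prod_eq [i] [j] (by simp) (by simp) hL (by simpa using hij)
  simpa using this

/-- The Cayley graph of a reflection system. -/
def graph (h : IsReflectionSystem a L) : SimpleGraph V where
  Adj g k := ∃ i, k = g * a i
  symm := ⟨fun g k ⟨i, hi⟩ => ⟨i, by rw [hi, mul_assoc, h.mul_self, mul_one]⟩⟩
  loopless := ⟨fun g ⟨i, hi⟩ => h.ne_one i (by simpa using hi.symm)⟩

theorem graph_adj_mul (h : IsReflectionSystem a L) (g : V) (i : κ) : h.graph.Adj g (g * a i) :=
  ⟨i, rfl⟩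

theorem graph_connected (h : IsReflectionSystem a L) : h.graph.Connected := by
  rw [SimpleGraph.connected_iff_exists_forall_reachable]
  refine ⟨1, fun g => ?_⟩
  have hg : g ∈ Subgroup.closure (Set.range a) := by simp [h.closure_range]
  induction hg using Subgroup.closure_induction_right with
  | one => exact SimpleGraph.Reachable.refl _
  | mul_right x _ y hy ih =>
    obtain ⟨i, rfl⟩ := hy
    exact ih.trans (h.graph_adj_mul x i).reachable
  | mul_inv_cancel x _ y hy ih =>
    obtain ⟨i, rfl⟩ := hy
    rw [← eq_inv_of_mul_eq_one_left (h.mul_self i)]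
    exact ih.trans (h.graph_adj_mul x i).reachable

theorem graph_isBipartite (h : IsReflectionSystem a L) : h.graph.IsBipartite := by
  obtain ⟨χ, hχ⟩ := h.exists_sign
  have hc : h.graph.Coloring Bool := SimpleGraph.Coloring.mk χ (by
    rintro g _ ⟨i, rfl⟩
    rw [hχ]
    simp)
  simpa using hc.colorable

/-- Repeating a generator means walking back along the same edge, which a trail forbids. The clause
on the first letter carries this through the induction. -/
theorem exists_word_of_isTrail (h : IsReflectionSystem a L) :
    ∀ {u v : V} (p : h.graph.Walk u v), p.IsTrail → ∃ l : List κ, l.length = p.length ∧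
      v = u * (l.map a).prod ∧ l.IsChain (· ≠ ·) ∧ ∀ i ∈ l.head?, s(u, u * a i) ∈ p.edges
  | u, _, .nil, _ => ⟨[], by simp⟩
  | u, v, .cons (v := w) hadj p, hp => by
    rw [SimpleGraph.Walk.isTrail_cons] at hp
    obtain ⟨l, hl, hprod, hchain, hhead⟩ := h.exists_word_of_isTrail p hp.1
    have hex : ∃ i, w = u * a i := hadj
    obtain ⟨i, hi⟩ := hex
    refine ⟨i :: l, by simp [hl], by rw [hprod, hi, List.map_cons, List.prod_cons, mul_assoc],
      hchain.cons fun j hj => ?_, by simp [← hi]⟩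
    rintro rfl
    have := hhead i hj
    rw [show w * a i = u by rw [hi, mul_assoc, h.mul_self, mul_one], Sym2.eq_swap] at this
    exact hp.2 this

theorem le_length_of_isCycle (h : IsReflectionSystem a L) {u : V} (p : h.graph.Walk u u)
    (hp : p.IsCycle) : L ≤ p.length := by
  obtain ⟨l, hl, hprod, hchain, -⟩ := h.exists_word_of_isTrail p hp.isTrail
  by_contra! hlt
  refine h.prod_ne_one l ?_ hchain (hl ▸ hlt) (by simpa using hprod.symm)
  rintro rfl
  have := hp.three_le_length
  simp at hl
  omega

end IsReflectionSystem

end CayleyGraph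

/-! ### From round elimination to a lower bound on Cayley graphs. -/

section LowerBound

open scoped ENNReal

namespace IsReflectionSystem

variable {V : Type*} [Group V] {d L : ℕ} {a : Fin d → V}

/-- The neighbours of `g` in the Cayley graph are numbered by the generators. -/
noncomputable def neighborEquiv (h : IsReflectionSystem a L) (hL : 3 ≤ L) (g : V) :
    Fin d ≃ h.graph.neighborSet g :=
  Equiv.ofBijective (fun i => ⟨g * a i, h.graph_adj_mul g i⟩)
    ⟨fun _ _ hij => h.injective hL (mul_left_cancel (Subtype.ext_iff.1 hij)),
      fun ⟨_, i, hi⟩ => ⟨i, Subtype.ext hi.symm⟩⟩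

variable [Fintype V]

theorem graph_isRegularOfDegree (h : IsReflectionSystem a L) (hL : 3 ≤ L)
    [DecidableRel h.graph.Adj] : h.graph.IsRegularOfDegree d := by
  intro g
  rw [← SimpleGraph.card_neighborSet_eq_degree, ← Fintype.card_congr (h.neighborEquiv hL g),
    Fintype.card_fin]

/-- Needed because `SimpleGraph.girth` is `0` on acyclic graphs. A tree has too few edges for all
degrees to be at least 2. -/
theorem graph_not_isAcyclic (h : IsReflectionSystem a L) (hL : 3 ≤ L) (hd : 2 ≤ d) :
    ¬ h.graph.IsAcyclic := by
  classical
  intro hac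
  have h1 := SimpleGraph.IsTree.card_edgeFinset (G := h.graph) ⟨h.graph_connected, hac⟩
  have h2 := h.graph.sum_degrees_eq_twice_card_edges
  simp only [(h.graph_isRegularOfDegree hL).degree_eq] at h2
  simp only [Finset.sum_const, Finset.card_univ, smul_eq_mul] at h2
  nlinarith

theorem le_girth (h : IsReflectionSystem a L) (hL : 3 ≤ L) (hd : 2 ≤ d) :
    L ≤ h.graph.girth := by
  obtain ⟨u, w, hw, hwl⟩ := SimpleGraph.exists_girth_eq_length.2 (h.graph_not_isAcyclic hL hd)
  rw [hwl]
  exact h.le_length_of_isCycle w hw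

theorem not_hasLocalColouring_wordBall {Ω : Type*} [MeasurableSpace Ω] {ν : Measure Ω}
    [IsProbabilityMeasure ν] (h : IsReflectionSystem a L) (hd : 0 < d) {η : ℝ≥0∞} (hη0 : η ≠ 0)
    (hη : (2 * d + 3) * η ≤ 1) (hηd : η * d ^ 2 < 1) (t : ℕ) (ht : 2 * t + 1 < L) :
    ¬ HasLocalColouring ν (fun i => Equiv.mulLeft (a i)) (wordBall a t)
      (η ^ ((6 * (d + 1)) ^ t)) := by
  have he : ∀ i g, Equiv.mulLeft (a i) (Equiv.mulLeft (a i) g) = g := fun i g => by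
    simp [← mul_assoc, h.mul_self]
  have hη1 : η ≤ 1 := by
    refine le_trans ?_ hη
    have h3 : (1 : ℝ≥0∞) ≤ 2 * d + 3 := le_add_left (by norm_num)
    simpa using mul_le_mul_left h3 η
  induction t with
  | zero =>
    rw [pow_zero, pow_one]
    refine not_hasLocalColouring_of_disjoint hd he (fun i => Set.disjoint_left.2 ?_) hηd
    rintro g ⟨l, hl, rfl⟩ ⟨l', hl', hp⟩
    rw [Nat.le_zero, List.length_eq_zero_iff] at hl hl'
    subst hl hl'
    exact h.ne_one i (by simpa using hp.symm)
  | succ t ih =>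
    intro hcol
    set m := (6 * (d + 1)) ^ t with hm
    have hm1 : 1 ≤ m := Nat.one_le_pow _ _ (by positivity)
    -- The factor 6 is twice the 3 of `shrink`: of the resulting `η ^ (2 * m)`, one factor `η ^ m`
    -- absorbs the constant `2 * d + 3`.
    have hexp : η ^ (6 * (d + 1)) ^ (t + 1) = (η ^ (2 * m)) ^ (3 * (d + 1)) := by
      rw [← pow_mul, pow_succ, ← hm]
      congr 1
      ring
    rw [hexp] at hcol
    have := hcol.shrink (S := wordBall a t) hd he (fun _ _ hij g hg => ?_) (pow_ne_zero _ hη0)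
      (pow_le_one₀ zero_le hη1)
    · obtain ⟨F, hF, hFB, hp⟩ := this
      refine ih (by omega) ⟨F, hF, hFB, fun i => (hp i).trans ?_⟩
      calc (2 * d + 3) * η ^ (2 * m) = ((2 * d + 3) * η ^ m) * η ^ m := by ring
        _ ≤ ((2 * d + 3) * η) * η ^ m := by
            gcongr
            exact pow_le_of_le_one zero_le hη1 (by omega)
        _ ≤ η ^ m := mul_le_of_le_one_left' hη
    · exact h.wordBall_inter_subset (by omega) hij ⟨⟨hg.1.2, hg.2.2⟩, hg.1.1⟩

end IsReflectionSystem

namespace LocalAlgorithm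

/-- The state of the node `g` after `t` rounds of `A` in a Cayley graph with generators `a`, when
port `i` of every node leads along the generator `a i`. -/
def cayleyState {V : Type} [Group V] {d : ℕ} {Out : Type} (A : LocalAlgorithm Out) (a : Fin d → V)
    (N Δ : ℕ) (x : V → unitInterval) : ℕ → V → A.State
  | 0, g => A.init N Δ d (x g)
  | t + 1, g => A.receive d (A.cayleyState a N Δ x t g) fun i =>
      A.send d (A.cayleyState a N Δ x t (g * a i)) i

variable {V : Type} [Group V] {d L : ℕ} {a : Fin d → V} {Out : Type} (A : LocalAlgorithm Out)

/-- Edges are right multiplications, so left translations preserve the network and its ports. -/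
theorem cayleyState_mul (N Δ : ℕ) (x : V → unitInterval) (t : ℕ) (g k : V) :
    A.cayleyState a N Δ x t (g * k) = A.cayleyState a N Δ (x ∘ Equiv.mulLeft g) t k := by
  induction t generalizing k with
  | zero => rfl
  | succ t ih => simp only [cayleyState, ih, mul_assoc]

theorem cayleyState_congr (N Δ : ℕ) {x y : V → unitInterval} (t : ℕ) (g : V)
    (hxy : ∀ k ∈ wordBall a t, x (g * k) = y (g * k)) :
    A.cayleyState a N Δ x t g = A.cayleyState a N Δ y t g := by
  induction t generalizing g with
  | zero =>
    have := hxy 1 ⟨[], by simp, by simp⟩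
    rw [mul_one] at this
    simp only [cayleyState, this]
  | succ t ih =>
    have h1 := ih g fun k ⟨l, hl, hk⟩ => hxy k ⟨l, by omega, hk⟩
    have h2 : ∀ i, A.cayleyState a N Δ x t (g * a i) = A.cayleyState a N Δ y t (g * a i) :=
      fun i => ih _ fun k ⟨l, hl, hk⟩ => by
        rw [mul_assoc]
        exact hxy _ ⟨i :: l, by simpa using hl, by simp [hk]⟩
    simp only [cayleyState, h1, h2]

theorem receive_cast {k k' : ℕ} (hk : k = k') (s : A.State) (f : Fin k' → A.Msg) :
    A.receive k s (fun i => f (finCongr hk i)) = A.receive k' s f := by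
  subst hk
  rfl

theorem send_cast {k k' : ℕ} (hk : k = k') (s : A.State) (i : Fin k) :
    A.send k s i = A.send k' s (finCongr hk i) := by
  subst hk
  rfl

variable [Fintype V]

/-- The port numbering of a Cayley graph by its generators. -/
noncomputable def _root_.IsReflectionSystem.ports (h : IsReflectionSystem a L) (hL : 3 ≤ L)
    [DecidableRel h.graph.Adj] : PortNumbering h.graph :=
  fun g => (finCongr (h.graph_isRegularOfDegree hL g)).trans (h.neighborEquiv hL g)

theorem stateAfter_graph (h : IsReflectionSystem a L) (hL : 3 ≤ L) [DecidableRel h.graph.Adj]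
    (x : V → unitInterval) (t : ℕ) (g : V) :
    A.stateAfter h.graph (h.ports hL) x t g =
      A.cayleyState a (Fintype.card V) h.graph.maxDegree x t g := by
  induction t generalizing g with
  | zero => simp only [stateAfter, cayleyState, h.graph_isRegularOfDegree hL g]
  | succ t ih =>
    simp only [stateAfter, cayleyState, ih]
    rw [← A.receive_cast (h.graph_isRegularOfDegree hL g)]
    congr 1
    funext i
    rw [A.send_cast (h.graph_isRegularOfDegree hL _)]
    congr 1
    -- Generators are involutions, so an edge has the same port number at both ends.
    have h3 : ((h.ports hL) (h.ports hL g i : V)).symm ⟨g, h.graph.adj_symm (h.ports hL g i).2⟩ =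
        (finCongr (h.graph_isRegularOfDegree hL _)).symm
          (finCongr (h.graph_isRegularOfDegree hL g) i) := by
      rw [Equiv.symm_apply_eq]
      refine Subtype.ext ?_
      change g = g * a (finCongr (h.graph_isRegularOfDegree hL g) i) *
        a (finCongr (h.graph_isRegularOfDegree hL g) i)
      rw [mul_assoc, h.mul_self, mul_one]
    rw [h3, Equiv.apply_symm_apply]

theorem not_coloursWithProbability_graph (h : IsReflectionSystem a L) (hL : 3 ≤ L)
    [DecidableRel h.graph.Adj] (hd : 2 ≤ d) (A : LocalAlgorithm (Fin d)) {t : ℕ}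
    (ht : 2 * t + 1 < L) {q : ℝ}
    (hq : 1 - q ≤ (((2 * d + 3) * d ^ 2 : ℝ)⁻¹) ^ ((6 * (d + 1)) ^ t)) :
    ¬ A.ColoursWithProbability h.graph (h.ports hL) t q := by
  rintro ⟨hmeas, hprob⟩
  have hd0 : (2 : ℝ) ≤ d := by exact_mod_cast hd
  have hpos : (0 : ℝ) < (2 * d + 3) * d ^ 2 := by positivity
  set η : ℝ := ((2 * d + 3) * d ^ 2 : ℝ)⁻¹ with hη
  have hηpos : 0 < η := inv_pos.2 hpos
  refine h.not_hasLocalColouring_wordBall (ν := (volume : Measure unitInterval)) (η := ENNReal.ofReal η) (by omega)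
    (by simpa using hηpos) ?_ ?_ t ht ?_
  · rw [show (2 * d + 3 : ℝ≥0∞) = ENNReal.ofReal (2 * d + 3) by
      rw [ENNReal.ofReal_add (by positivity) (by positivity), ENNReal.ofReal_mul (by positivity)]
      simp, ← ENNReal.ofReal_mul (by positivity)]
    refine ENNReal.ofReal_le_one.2 ?_
    rw [hη, ← div_eq_mul_inv, div_le_one hpos]
    nlinarith
  · rw [show (d ^ 2 : ℝ≥0∞) = ENNReal.ofReal (d ^ 2) by
      rw [ENNReal.ofReal_pow (by positivity)]; simp, ← ENNReal.ofReal_mul hηpos.le]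
    refine ENNReal.ofReal_lt_one.2 ?_
    rw [hη, inv_mul_eq_div, div_lt_one hpos]
    nlinarith [sq_nonneg (d : ℝ)]
  have hrun : ∀ x g, A.run h.graph (h.ports hL) t x g =
      A.run h.graph (h.ports hL) t (x ∘ Equiv.mulLeft g) 1 := by
    intro x g
    simp only [run, stateAfter_graph]
    rw [← cayleyState_mul, mul_one]
  refine ⟨fun x => A.run h.graph (h.ports hL) t x 1, hmeas 1,
    fun (x y : V → unitInterval) hxy => ?_, fun i => ?_⟩
  · simp only [run, stateAfter_graph]
    rw [A.cayleyState_congr (y := y) _ _ t 1 fun k hk => by simpa using hxy k hk]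
  · set E := {x | A.run h.graph (h.ports hL) t x 1 = i ∧
      A.run h.graph (h.ports hL) t (x ∘ Equiv.mulLeft (a i)) 1 = i} with hE
    have hEm : MeasurableSet E := by
      simp only [hE, ← hrun]
      exact (hmeas 1 (measurableSet_singleton i)).inter (hmeas (a i) (measurableSet_singleton i))
    -- On `E` the adjacent nodes `1` and `a i` both output `i`, so `E` has at most the failure
    -- probability.
    have hdisj : Disjoint {x | IsProperNodeColouring h.graph (A.run h.graph (h.ports hL) t x)} E := by
      refine Set.disjoint_left.2 fun x hx hxE => hx 1 (a i) ⟨i, (one_mul _).symm⟩ ?_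
      rw [hrun x (a i), hxE.1, hxE.2]
    have h1 := measureReal_union (μ := (volume : Measure (V → unitInterval))) hdisj hEm
    have h2 := measureReal_le_one (μ := (volume : Measure (V → unitInterval)))
      (s := {x | IsProperNodeColouring h.graph (A.run h.graph (h.ports hL) t x)} ∪ E)
    have h3 : (volume : Measure (V → unitInterval)).real E ≤ η ^ ((6 * (d + 1)) ^ t) := by
      linarith
    rw [← ENNReal.ofReal_pow hηpos.le]
    exact (ENNReal.le_ofReal_iff_toReal_le (measure_ne_top _ _) (by positivity)).2 h3

end LocalAlgorithm

end LowerBound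

/-! ### Inversions in disjoint circles modulo a prime. -/

section MatrixReflections

/-- The inversion in the circle with centre `3 * i` and radius `1`, as a matrix. -/
def inversionMatrix (R : Type*) [CommRing R] (i : ℕ) : Matrix (Fin 2) (Fin 2) R :=
  !![3 * i, 1 - (3 * i) ^ 2; 1, -(3 * i)]

theorem inversionMatrix_mul_self (R : Type*) [CommRing R] (i : ℕ) :
    inversionMatrix R i * inversionMatrix R i = 1 := by
  ext j k
  fin_cases j <;> fin_cases k <;>
    simp [inversionMatrix, Matrix.mul_apply, Fin.sum_univ_two] <;> ring

theorem det_inversionMatrix (R : Type*) [CommRing R] (i : ℕ) : (inversionMatrix R i).det = -1 := by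
  rw [inversionMatrix, Matrix.det_fin_two_of]
  ring

/-- The image of `(1, 0)` under a product of inversion matrices. -/
def inversionOrbit : List ℕ → ℤ × ℤ
  | [] => (1, 0)
  | i :: l =>
    (3 * i * (inversionOrbit l).1 + (1 - (3 * i) ^ 2) * (inversionOrbit l).2,
      (inversionOrbit l).1 - 3 * i * (inversionOrbit l).2)

/-- Ping-pong: starting from infinity, the point `x / y` ends inside the circle of the last
inversion applied. Centres are at distance at least 3, so a point inside circle `j` is outside
circle `i` and is moved inside it. -/
theorem abs_fst_sub_lt_snd_inversionOrbit (i : ℕ) (l : List ℕ) (hl : (i :: l).IsChain (· ≠ ·)) :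
    |(inversionOrbit (i :: l)).1 - 3 * i * (inversionOrbit (i :: l)).2| <
      |(inversionOrbit (i :: l)).2| := by
  induction l generalizing i with
  | nil => simp [inversionOrbit]
  | cons j l ih =>
    have h1 := ih j hl.tail
    have hij : i ≠ j := (List.isChain_cons_cons.1 hl).1
    rw [inversionOrbit]
    set x := (inversionOrbit (j :: l)).1
    set y := (inversionOrbit (j :: l)).2
    have h2 : 3 * (i : ℤ) * x + (1 - (3 * i) ^ 2) * y - 3 * i * (x - 3 * i * y) = y := by ring
    simp only [h2]
    have h3 : 3 * |y| ≤ |(3 * j - 3 * i) * y| := by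
      rw [abs_mul]
      refine mul_le_mul_of_nonneg_right ?_ (abs_nonneg y)
      rw [le_abs]
      omega
    have h4 : |(3 * j - 3 * i) * y| ≤ |x - 3 * i * y| + |x - 3 * j * y| := by
      have : (3 * (j : ℤ) - 3 * i) * y = (x - 3 * i * y) - (x - 3 * j * y) := by ring
      rw [this]
      exact abs_sub _ _
    have := abs_nonneg y
    have := abs_nonneg (x - 3 * j * y)
    omega

theorem abs_snd_inversionOrbit_le {d : ℕ} (i : ℕ) (l : List ℕ) (hl : (i :: l).IsChain (· ≠ ·))
    (hd : ∀ j ∈ i :: l, j < d) :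
    |(inversionOrbit (i :: l)).2| ≤ (3 * d + 1) ^ l.length := by
  induction l generalizing i with
  | nil => simp [inversionOrbit]
  | cons j l ih =>
    have h1 := abs_fst_sub_lt_snd_inversionOrbit j l hl.tail
    have h2 := ih j hl.tail fun k hk => hd k (List.mem_cons_of_mem _ hk)
    rw [inversionOrbit]
    set x := (inversionOrbit (j :: l)).1
    set y := (inversionOrbit (j :: l)).2
    have h3 : |(3 * (j : ℤ) - 3 * i) * y| ≤ 3 * d * |y| := by
      rw [abs_mul]
      refine mul_le_mul_of_nonneg_right ?_ (abs_nonneg y)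
      have := hd i (by simp)
      have := hd j (by simp)
      rw [abs_le]
      omega
    have h4 : |x - 3 * i * y| ≤ |x - 3 * j * y| + |(3 * (j : ℤ) - 3 * i) * y| := by
      have : x - 3 * i * y = (x - 3 * j * y) + (3 * (j : ℤ) - 3 * i) * y := by ring
      rw [this]
      exact abs_add_le _ _
    calc |x - 3 * i * y| ≤ |y| * (3 * d + 1) := by linarith
      _ ≤ (3 * d + 1) ^ l.length * (3 * d + 1) := by gcongr
      _ = (3 * d + 1) ^ (j :: l).length := by rw [List.length_cons, pow_succ]

theorem prod_inversionMatrix_mulVec (R : Type*) [CommRing R] (l : List ℕ) :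
    Matrix.mulVec (l.map (inversionMatrix R)).prod ![1, 0] =
      ![((inversionOrbit l).1 : R), ((inversionOrbit l).2 : R)] := by
  induction l with
  | nil => simp [inversionOrbit]
  | cons i l ih =>
    rw [List.map_cons, List.prod_cons, ← Matrix.mulVec_mulVec, ih]
    ext j
    fin_cases j <;> simp [inversionMatrix, inversionOrbit, Matrix.mulVec, dotProduct]; ring

/-- The lower left entry is an integer that is nonzero by ping-pong and smaller than `p` in absolute
value, so it survives reduction modulo `p`. -/
theorem prod_inversionMatrix_ne_one {p d : ℕ} (l : List ℕ) (hl : l ≠ [])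
    (hc : l.IsChain (· ≠ ·)) (hd : ∀ j ∈ l, j < d) (hp : (3 * d + 1) ^ (l.length - 1) < p) :
    (l.map (inversionMatrix (ZMod p))).prod ≠ 1 := by
  intro h
  have h1 := congrFun (prod_inversionMatrix_mulVec (ZMod p) l) 1
  rw [h, Matrix.one_mulVec] at h1
  match l, hl with
  | i :: l, _ =>
    simp only [Matrix.cons_val_one, Matrix.cons_val_fin_one] at h1
    have h2 := (ZMod.intCast_zmod_eq_zero_iff_dvd _ p).1 h1.symm
    have h3 := abs_fst_sub_lt_snd_inversionOrbit i l hc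
    have h4 := abs_snd_inversionOrbit_le i l hc hd
    have h5 : |(inversionOrbit (i :: l)).2| < p := h4.trans_lt (by
      simp only [List.length_cons, Nat.add_sub_cancel] at hp
      exact_mod_cast hp)
    have h6 := Int.eq_zero_of_abs_lt_dvd h2 h5
    rw [h6, abs_zero] at h3
    exact absurd h3 (abs_nonneg _).not_gt

/-- The inversion matrices as invertible matrices. -/
def inversionUnit (R : Type*) [CommRing R] (i : ℕ) : (Matrix (Fin 2) (Fin 2) R)ˣ :=
  ⟨inversionMatrix R i, inversionMatrix R i, inversionMatrix_mul_self R i,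
    inversionMatrix_mul_self R i⟩

theorem det_mem_closure_inversionUnit {R : Type*} [CommRing R] {d : ℕ}
    {g : (Matrix (Fin 2) (Fin 2) R)ˣ}
    (hg : g ∈ Subgroup.closure (Set.range fun i : Fin d => inversionUnit R i)) :
    g.val.det = 1 ∨ g.val.det = -1 := by
  have hdet : ∀ i : Fin d, (inversionUnit R i).val.det = -1 := fun i => det_inversionMatrix R i
  induction hg using Subgroup.closure_induction_right with
  | one => simp
  | mul_right x _ y hy ih =>
    obtain ⟨i, rfl⟩ := hy
    rw [Units.val_mul, Matrix.det_mul, hdet]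
    rcases ih with h | h <;> simp [h]
  | mul_inv_cancel x _ y hy ih =>
    obtain ⟨i, rfl⟩ := hy
    rw [Units.val_mul, Matrix.det_mul, show (inversionUnit R i)⁻¹ = inversionUnit R i from rfl, hdet]
    rcases ih with h | h <;> simp [h]

/-- The group generated by `d` inversions modulo `p`. -/
abbrev InversionGroup (d p : ℕ) : Type :=
  Subgroup.closure (Set.range fun i : Fin d => inversionUnit (ZMod p) i)

/-- The generators of `InversionGroup d p`. -/
def inversionGen (d p : ℕ) (i : Fin d) : InversionGroup d p :=
  ⟨inversionUnit (ZMod p) i, Subgroup.subset_closure ⟨i, rfl⟩⟩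

theorem isReflectionSystem_inversionGen {d p L : ℕ} (hp : 2 < p)
    (hL : (3 * d + 1) ^ (L - 2) < p) : IsReflectionSystem (inversionGen d p) L where
  mul_self i := Subtype.ext (Units.ext (inversionMatrix_mul_self _ _))
  closure_range := by
    have : Set.range (inversionGen d p) = Subtype.val ⁻¹'
        (Set.range fun i : Fin d => inversionUnit (ZMod p) i) := by
      ext g
      simp [inversionGen, Subtype.ext_iff]
    rw [this]
    exact Subgroup.closure_closure_coe_preimage
  exists_sign := by
    classical
    refine ⟨fun g => decide (g.val.val.det = 1), fun g i => ?_⟩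
    have h1 : (g * inversionGen d p i).val.val.det = -g.val.val.det := by
      have : (g * inversionGen d p i).val.val = g.val.val * inversionMatrix (ZMod p) i := rfl
      rw [this, Matrix.det_mul, det_inversionMatrix, mul_neg_one]
    -- The determinant distinguishes the two classes only if `-1 ≠ 1` modulo `p`.
    have : Fact (2 < p) := ⟨hp⟩
    have h2 : (-1 : ZMod p) ≠ 1 := ZMod.neg_one_ne_one
    simp only [h1]
    rcases det_mem_closure_inversionUnit g.2 with h | h <;> simp [h, h2]
  prod_ne_one l hl hc hlen h := by
    refine prod_inversionMatrix_ne_one (p := p) (d := d) (l.map Fin.val) (by simpa using hl)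
      ?_ ?_ ?_ ?_
    · rw [List.isChain_map]
      exact hc.imp fun i j hij => by simpa [Fin.ext_iff] using hij
    · simp only [List.mem_map]
      rintro _ ⟨j, -, rfl⟩
      exact j.2
    · refine lt_of_le_of_lt (Nat.pow_le_pow_right (by omega) ?_) hL
      rw [List.length_map]
      omega
    · have h1 := congrArg (fun g : InversionGroup d p => g.val.val) h
      have h2 : ∀ l : List (Fin d), ((l.map (inversionGen d p)).prod).val.val =
          ((l.map Fin.val).map (inversionMatrix (ZMod p))).prod := by
        intro l
        induction l with
        | nil => rfl
        | cons i l ih =>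
          simp only [List.map_cons, List.prod_cons, Subgroup.coe_mul, Units.val_mul, ih]
          rfl
      exact (h2 l).symm.trans h1

theorem card_inversionGroup_le (d p : ℕ) [NeZero p] : Nat.card (InversionGroup d p) ≤ p ^ 4 := by
  have h1 : Function.Injective fun g : InversionGroup d p => g.val.val :=
    Units.val_injective.comp Subtype.val_injective
  refine (Nat.card_le_card_of_injective _ h1).trans_eq ?_
  simp [Matrix, Nat.card_eq_fintype_card, ← pow_mul]

/-- A reflection system on two or more generators has a relation of length twice the order of the
group. -/
theorem IsReflectionSystem.le_two_mul_card {V : Type*} [Group V] [Fintype V] {d L : ℕ}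
    {a : Fin d → V} (h : IsReflectionSystem a L) (hd : 2 ≤ d) : L ≤ 2 * Fintype.card V := by
  by_contra! hlt
  let i : Fin d := ⟨0, by omega⟩
  let j : Fin d := ⟨1, by omega⟩
  have hij : i ≠ j := by simp [i, j]
  have key : ∀ n : ℕ, ∃ l : List (Fin d), l.length = 2 * n ∧ l.IsChain (· ≠ ·) ∧
      (∀ k ∈ l.head?, k = i) ∧ (l.map a).prod = (a i * a j) ^ n := by
    intro n
    induction n with
    | zero => exact ⟨[], by simp⟩
    | succ n ih =>
      obtain ⟨l, hl, hc, hh, hp⟩ := ih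
      refine ⟨i :: j :: l, by simp [hl]; ring, ?_, by simp, ?_⟩
      · refine List.isChain_cons_cons.2 ⟨hij, hc.cons fun k hk => ?_⟩
        rw [hh k hk]
        exact hij.symm
      · rw [List.map_cons, List.map_cons, List.prod_cons, List.prod_cons, hp, pow_succ', mul_assoc]
  obtain ⟨l, hl, hc, -, hp⟩ := key (Fintype.card V)
  refine h.prod_ne_one l ?_ hc (hl ▸ hlt) (by rw [hp, pow_card_eq_one])
  rintro rfl
  have : 0 < Fintype.card V := Fintype.card_pos
  simp at hl

end MatrixReflections

/-! ### Growth estimates and choice of the prime. -/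

section Main

theorem IsReflectionSystem.exists_of_equiv {V W κ : Type*} [Group V] {a : κ → V} {L : ℕ}
    (h : IsReflectionSystem a L) (e : V ≃ W) :
    ∃ (_ : Group W) (a' : κ → W), IsReflectionSystem a' L := by
  let _ : Group W := e.symm.group
  have hmul : ∀ x y, e (x * y) = e x * e y := fun x y => by
    change e (x * y) = e (e.symm (e x) * e.symm (e y))
    simp
  let f : V ≃* W := { e with map_mul' := hmul }
  refine ⟨inferInstance, f ∘ a, fun i => ?_, ?_, ?_, fun l hl hc hlen hp => ?_⟩
  · rw [Function.comp_apply, ← map_mul, h.mul_self, map_one]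
  · rw [Set.range_comp, ← MulEquiv.coe_toMonoidHom, ← MonoidHom.map_closure, h.closure_range,
      Subgroup.map_top_of_surjective _ f.surjective]
  · obtain ⟨χ, hχ⟩ := h.exists_sign
    refine ⟨χ ∘ f.symm, fun g i => ?_⟩
    simp [hχ]
  · refine h.prod_ne_one l hl hc hlen (f.injective ?_)
    rw [map_one, map_list_prod, List.map_map, hp]

/-- The growth conditions on a running time that are needed for the lower bound hold for every
function that is `o(log log n)`. -/
theorem eventually_runningTime_small {T : ℕ → ℕ}
    (hT : (fun n : ℕ => (T n : ℝ)) =o[atTop] fun n : ℕ => Real.log (Real.log (n : ℝ)))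
    {γ c M : ℝ} (hγ : 0 < γ) (hc : 0 < c) (hM : 1 < M) {K : ℕ} (hK : 1 < K) :
    ∀ᶠ n : ℕ in atTop, 2 * (T n : ℝ) + 2 ≤ γ * Real.log n ∧
      1 / (n : ℝ) ^ c ≤ M⁻¹ ^ (K ^ T n) := by
  have hs : Tendsto (fun n : ℕ => √(Real.log (n : ℝ))) atTop atTop :=
    Real.tendsto_sqrt_atTop.comp (Real.tendsto_log_atTop.comp tendsto_natCast_atTop_atTop)
  have hKlog : 0 < Real.log K := Real.log_pos (by exact_mod_cast hK)
  have hMlog : 0 < Real.log M := Real.log_pos hM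
  filter_upwards [hT.bound one_pos, hT.bound (c := 1 / (2 * Real.log K)) (by positivity),
    hs.eventually_ge_atTop 1, hs.eventually_ge_atTop (6 / γ),
    hs.eventually_ge_atTop (Real.log M / c), eventually_gt_atTop 0] with n h1 h2 h3 h4 h5 hn
  -- The hypothesis on `T` gives `K ^ T n ≤ s`, and `M ^ s ≤ n ^ c` because `log n = s ^ 2`.
  set s := √(Real.log (n : ℝ)) with hsdef
  have hs0 : 0 < s := by linarith
  have hlog : Real.log (n : ℝ) = s ^ 2 := (Real.sq_sqrt (Real.sqrt_pos.1 hs0).le).symm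
  have hloglog : Real.log (Real.log (n : ℝ)) = 2 * Real.log s := by
    rw [hlog, Real.log_pow]
    norm_num
  have hlogs : 0 ≤ Real.log s := Real.log_nonneg h3
  rw [hloglog, Real.norm_of_nonneg (by positivity), Real.norm_of_nonneg (by positivity)] at h1 h2
  rw [hlog]
  constructor
  · have h6 : Real.log s ≤ s := (Real.log_le_sub_one_of_pos hs0).trans (by linarith)
    have h7 : 6 ≤ γ * s := by rwa [div_le_iff₀' hγ] at h4
    nlinarith
  · have hKT : ((K ^ T n : ℕ) : ℝ) ≤ s := by
      have h8 : (T n : ℝ) * Real.log K ≤ Real.log s := by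
        have := mul_le_mul_of_nonneg_right h2 hKlog.le
        have h9 : 1 / (2 * Real.log K) * (2 * Real.log s) * Real.log K = Real.log s := by
          field_simp
        linarith
      rw [Nat.cast_pow, ← Real.log_le_log_iff (by positivity) hs0, Real.log_pow]
      exact h8
    have hn' : (0 : ℝ) < n := by exact_mod_cast hn
    rw [← Real.log_le_log_iff (by positivity) (by positivity), one_div, Real.log_inv,
      Real.log_rpow hn', Real.log_pow, Real.log_inv, hlog, mul_neg, neg_le_neg_iff]
    have h10 : Real.log M ≤ c * s := by rwa [div_le_iff₀' hc] at h5
    calc ((K ^ T n : ℕ) : ℝ) * Real.log M ≤ s * (c * s) := by gcongr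
      _ = c * s ^ 2 := by ring

theorem mainTheorem6 (d : ℕ) (hd : 2 ≤ d) :
    ∃ γ : ℝ, 0 < γ ∧ ∀ c : ℝ, 0 < c →
      ¬ ∃ (A : LocalAlgorithm (Fin d)) (T : ℕ → ℕ),
        ((fun n : ℕ => (T n : ℝ)) =o[atTop] fun n : ℕ => Real.log (Real.log (n : ℝ))) ∧
        ∀ᶠ n : ℕ in atTop,
          ∀ (G : SimpleGraph (Fin n)) [DecidableRel G.Adj] (P : PortNumbering G),
            G.Connected → G.IsRegularOfDegree d → G.IsBipartite →
            γ * Real.log (n : ℝ) ≤ (G.girth : ℝ) →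
            A.ColoursWithProbability G P (T n) (1 - 1 / (n : ℝ) ^ c) := by
  classical
  have hb : 1 < 3 * d + 1 := by omega
  have hblog : 0 < Real.log ((3 * d + 1 : ℕ) : ℝ) := Real.log_pos (by exact_mod_cast hb)
  set γ : ℝ := 1 / (4 * Real.log ((3 * d + 1 : ℕ) : ℝ)) with hγ
  have hγ0 : 0 < γ := by positivity
  refine ⟨γ, hγ0, ?_⟩
  rintro c hc ⟨A, T, hT, hA⟩
  have hd0 : (2 : ℝ) ≤ d := by exact_mod_cast hd
  have hsmall := eventually_runningTime_small hT hγ0 hc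
    (M := (2 * d + 3) * d ^ 2) (by nlinarith [sq_nonneg (d : ℝ)]) (K := 6 * (d + 1)) (by omega)
  obtain ⟨N, hN⟩ := eventually_atTop.1 (hA.and hsmall)
  -- The power forces the group order to be at least `N`, through `le_two_mul_card`; the `3` ensures
  -- `2 < p`.
  obtain ⟨p, hpN, hp⟩ := Nat.exists_infinite_primes ((3 * d + 1) ^ (2 * N) + 3)
  have hp0 : NeZero p := ⟨hp.ne_zero⟩
  have hsys : IsReflectionSystem (inversionGen d p) (Nat.clog (3 * d + 1) p + 1) :=
    isReflectionSystem_inversionGen (by omega) (Nat.pow_pred_clog_lt_self hb hp.one_lt)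
  have : Fintype (InversionGroup d p) := Fintype.ofFinite _
  have hle := Nat.le_pow_clog hb p
  have hcard := card_inversionGroup_le d p
  rw [Nat.card_eq_fintype_card] at hcard
  have hnN : N ≤ Fintype.card (InversionGroup d p) := by
    have h1 := hsys.le_two_mul_card hd
    have h2 : 2 * N ≤ Nat.clog (3 * d + 1) p :=
      (Nat.pow_le_pow_iff_right hb).1 (by omega)
    omega
  obtain ⟨_, a', hsys'⟩ := hsys.exists_of_equiv (Fintype.equivFin (InversionGroup d p))
  have hn0 : 0 < Fintype.card (InversionGroup d p) := Fintype.card_pos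
  generalize Fintype.card (InversionGroup d p) = n at *
  obtain ⟨hAn, hT1, hT2⟩ := hN n hnN
  -- The 4 in `γ` comes from `n ≤ p ^ 4`.
  have hγL : γ * Real.log n ≤ Nat.clog (3 * d + 1) p := by
    have h1 : Real.log n ≤ 4 * Real.log p := by
      have : Real.log ((p : ℝ) ^ 4) = 4 * Real.log p := by rw [Real.log_pow]; norm_num
      rw [← this]
      exact Real.log_le_log (by exact_mod_cast hn0) (by exact_mod_cast hcard)
    have h2 : Real.log p ≤ Nat.clog (3 * d + 1) p * Real.log ((3 * d + 1 : ℕ) : ℝ) := by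
      rw [← Real.log_pow]
      exact Real.log_le_log (by exact_mod_cast hp.pos) (by exact_mod_cast hle)
    rw [hγ, one_div_mul_eq_div, div_le_iff₀ (by positivity)]
    linarith
  have hTL : 2 * T n + 2 ≤ Nat.clog (3 * d + 1) p := by exact_mod_cast hT1.trans hγL
  have hL : 3 ≤ Nat.clog (3 * d + 1) p + 1 := by omega
  refine LocalAlgorithm.not_coloursWithProbability_graph hsys' hL hd A (t := T n) (by omega)
    (q := 1 - 1 / (n : ℝ) ^ c) (by simpa using hT2) (hAn hsys'.graph (hsys'.ports hL)
      hsys'.graph_connected (hsys'.graph_isRegularOfDegree hL) hsys'.graph_isBipartite ?_)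
  refine hγL.trans ?_
  exact_mod_cast (Nat.le_succ _).trans (hsys'.le_girth hL hd)

end Main
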